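/- For each positive integer $N$ let $X_N=\sum_{n=1}^N \frac{s_n}{n}$, where $s_1,\dots,s_N$ are independent random variables, each uniformly distributed in $\{-1,+1\}$. Let $$g(x):=2\int_0^{+\infty}\cos(2\pi u x)\prod_{n=1}^{+\infty}\cos\!\Big(\frac{2\pi u}{n}\Big)\,\mathrm{d}u\qquad(x\in\mathbb{R}),$$ where the infinite product converges for every real $u$, the integral converges absolutely for every real $x$, and $g$ is locally integrable. Let $C$ be any positive constant less than $1/\log 4$. Then, for all bounded intervals $I\subseteq\mathbb{R}$ of length $|I|>\exp\!\left(-C(\log N)^2\right)$, one has $$\mathbb{P}[X_N\in I]=\int_I g(x)\,\mathrm{d}x+o(|I|)\qquad\text{as }N\to\infty,$$ uniformly in $I$; that is, for every $\varepsilon>0$ there is $N_0=N_0(C,\varepsilon)$ such that for every $N\ge N_0$ and every bounded interval $I$ with $|I|>\exp\!\left(-C(\log N)^2\right)$, $$\Big|\mathbb{P}[X_N\in I]-\int_I g(x)\,\mathrm{d}x\Big|\le\varepsilon|I|.$$ -/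

import Mathlib

/-- The signed harmonic sum `X_N = ∑_{n=1}^N s_n / n` attached to `N` signs, as a function on the
sample space `Ω`. The index `i : Fin N` stands for `n = i + 1`. -/
noncomputable def signedHarmonicSum {Ω : Type*} (N : ℕ) (s : Fin N → Ω → ℝ) (ω : Ω) : ℝ :=
  ∑ i : Fin N, s i ω / ((i : ℝ) + 1)

/-- The infinite product `∏_{n ≥ 1} cos (2 π u / n)`; the index `k : ℕ` stands for `n = k + 1`. -/
noncomputable def cosProd (u : ℝ) : ℝ :=
  ∏' k : ℕ, Real.cos (2 * Real.pi * u / ((k : ℝ) + 1))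

/-- The limiting density
`g x = 2 ∫_0^∞ cos (2 π u x) ∏_{n ≥ 1} cos (2 π u / n) du`. -/
noncomputable def limitDensity (x : ℝ) : ℝ :=
  2 * ∫ u in Set.Ioi (0 : ℝ), Real.cos (2 * Real.pi * u * x) * cosProd u

open Real Filter Topology MeasureTheory ProbabilityTheory

/-! The characteristic function of `X_N` at `2πu` is `cosPartialProd N u`, and `limitDensity` is the
Fourier inverse of its limit `cosProd`. The theorem is thus a comparison of the two products, and
what matters is how far out the finite ones are small. Arithmetic gives the decay. A factor with
prime index `p` is close to `±1` only if `2u/p` is near an integer, so that `p` divides some integer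
near `2u`. There are few such integers and each has few prime factors, so most primes up to `N`
contribute a definite saving. Hence `|cosPartialProd N u| ≤ 1/u²` from a fixed point up to `exp(C
log² N)`, for any `C` (`exists_abs_cosPartialProd_le_of_le`), and dominated convergence makes the
products close in `L¹` on that range (`tendsto_integral_abs_cosPartialProd_sub`). Beyond the range
the test function must supply the decay. Tents of width `h` have transforms of size `1/(hu)²`, so
`X_N` and the limit law agree on them up to `o(h)` (`eventually_integral_cosPartialProd_sub_le`). A
bounded number of tents approximates the indicator of an interval
(`abs_measureReal_sub_integral_le`). -/

/-- The finite product `∏_{n ≤ N} cos (2 π u / n)`, the characteristic function of the signed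
harmonic sum `X_N` at `2 π u`. -/
noncomputable def cosPartialProd (N : ℕ) (u : ℝ) : ℝ :=
  ∏ k ∈ Finset.range N, cos (2 * π * u / ((k : ℝ) + 1))

/-! ### Decay of the cosine products, from prime denominators. -/

theorem abs_cos_pi_mul_le (y : ℝ) : |cos (π * y)| ≤ exp (-2 * (y - round y) ^ 2) := by
  set d := y - round y with hd
  have hd2 : |d| ≤ 1 / 2 := abs_sub_round y
  have h1 : |cos (π * y)| = |cos (π * d)| := by
    have : π * d = π * y - round y * π := by rw [hd]; ring
    rw [this, Real.cos_sub_int_mul_pi, abs_mul, abs_zpow, abs_neg, abs_one, one_zpow, one_mul]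
  have hπ := Real.pi_pos
  have hle := abs_le.1 hd2
  have h2 : 0 ≤ cos (π * d) := by
    apply Real.cos_nonneg_of_neg_pi_div_two_le_of_le <;> nlinarith
  have h3 : |π * d| ≤ π := by
    rw [abs_mul, abs_of_pos hπ]; nlinarith
  rw [h1, abs_of_nonneg h2]
  have h4 := Real.cos_le_one_sub_mul_cos_sq h3
  have h5 : 2 / π ^ 2 * (π * d) ^ 2 = 2 * d ^ 2 := by field_simp
  have h6 := Real.add_one_le_exp (-2 * d ^ 2)
  linarith

theorem two_pow_card_primeFactors_le {m : ℕ} (hm : m ≠ 0) : 2 ^ m.primeFactors.card ≤ m := by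
  calc 2 ^ m.primeFactors.card ≤ ∏ p ∈ m.primeFactors, p :=
        Finset.pow_card_le_prod _ _ _ fun p hp => (Nat.prime_of_mem_primeFactors hp).two_le
    _ ≤ m := Nat.le_of_dvd (Nat.pos_of_ne_zero hm) (Nat.prod_primeFactors_dvd m)

/-- Limits how many primes a single integer near `2u` can spoil. -/
theorem card_primeFactors_le_log_div_log {m : ℕ} (hm : m ≠ 0) :
    (m.primeFactors.card : ℝ) ≤ log m / log 2 := by
  rw [le_div_iff₀ (log_pos one_lt_two), ← log_pow]
  apply log_le_log (by positivity)
  exact_mod_cast two_pow_card_primeFactors_le hm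

theorem abs_cosPartialProd_le_one (N : ℕ) (u : ℝ) : |cosPartialProd N u| ≤ 1 := by
  rw [cosPartialProd, Finset.abs_prod]
  exact Finset.prod_le_one (fun _ _ => abs_nonneg _) fun _ _ => abs_cos_le_one _

theorem abs_cosPartialProd_anti {M N : ℕ} (h : M ≤ N) (u : ℝ) :
    |cosPartialProd N u| ≤ |cosPartialProd M u| := by
  rw [cosPartialProd, cosPartialProd, Finset.abs_prod, Finset.abs_prod]
  exact Finset.prod_le_prod_of_subset_of_le_one (Finset.range_mono h)
    (fun _ _ => abs_nonneg _) fun _ _ _ => abs_cos_le_one _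

/-- The primes `p ≤ M` for which `2 u / p` is within `δ` of an integer are few, since each of them
divides an integer within `δ M` of `2 u`. -/
theorem card_primes_near_integer_le {M : ℕ} {u δ : ℝ} (hδ : 0 < δ) (hu1 : 1 ≤ u)
    (hu : δ * M < 2 * u) :
    (((Nat.primesLE M).filter fun p : ℕ => |2 * u / p - round (2 * u / p)| < δ).card : ℝ) ≤
      (2 * (δ * M) + 1) * (log (2 * u + δ * M) / log 2) := by
  set D := δ * M with hD
  have hD0 : 0 ≤ D := by positivity
  set J : Finset ℤ := Finset.Icc ⌈2 * u - D⌉ ⌊2 * u + D⌋ with hJ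
  have hmem : ∀ m ∈ J, 0 < m ∧ (m : ℝ) ≤ 2 * u + D := by
    intro m hm
    rw [hJ, Finset.mem_Icc, Int.ceil_le, Int.le_floor] at hm
    refine ⟨?_, hm.2⟩
    have : (0 : ℝ) < m := by linarith
    exact_mod_cast this
  have hsub : ((Nat.primesLE M).filter fun p : ℕ => |2 * u / p - round (2 * u / p)| < δ) ⊆
      J.biUnion fun m => m.natAbs.primeFactors := by
    intro p hp
    rw [Finset.mem_filter, Nat.mem_primesLE] at hp
    obtain ⟨⟨hpM, hpp⟩, hpδ⟩ := hp
    have hp0 : (0 : ℝ) < p := by exact_mod_cast hpp.pos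
    have hpM' : (p : ℝ) ≤ M := by exact_mod_cast hpM
    have h1 : |2 * u - p * round (2 * u / p)| ≤ D := by
      have : 2 * u - p * round (2 * u / p) = p * (2 * u / p - round (2 * u / p)) := by
        field_simp
      rw [this, abs_mul, abs_of_pos hp0, hD]
      nlinarith
    have hmJ : (p : ℤ) * round (2 * u / p) ∈ J := by
      rw [hJ, Finset.mem_Icc, Int.ceil_le, Int.le_floor]
      push_cast
      have := abs_le.1 h1
      constructor <;> linarith
    rw [Finset.mem_biUnion]
    refine ⟨_, hmJ, ?_⟩
    rw [Nat.mem_primeFactors]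
    refine ⟨hpp, ?_, ?_⟩
    · rw [← Int.natCast_dvd]; exact dvd_mul_right _ _
    · have := (hmem _ hmJ).1
      exact Int.natAbs_ne_zero.2 this.ne'
  have hlog2 : 0 < log 2 := log_pos one_lt_two
  have hcard : (J.card : ℝ) ≤ 2 * D + 1 := by
    rw [hJ, Int.card_Icc]
    have h1 := Int.le_ceil (2 * u - D)
    have h2 := Int.floor_le (2 * u + D)
    rcases le_total 0 (⌊2 * u + D⌋ + 1 - ⌈2 * u - D⌉) with h | h
    · have : (((⌊2 * u + D⌋ + 1 - ⌈2 * u - D⌉).toNat : ℤ) : ℝ) =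
          ((⌊2 * u + D⌋ + 1 - ⌈2 * u - D⌉ : ℤ) : ℝ) := by rw [Int.toNat_of_nonneg h]
      rw [Int.cast_natCast] at this
      rw [this]; push_cast; linarith
    · rw [Int.toNat_of_nonpos h]; simp; linarith
  have hb : ∀ m ∈ J, ((m.natAbs.primeFactors.card : ℕ) : ℝ) ≤ log (2 * u + D) / log 2 := by
    intro m hm
    obtain ⟨h0, h1⟩ := hmem m hm
    refine (card_primeFactors_le_log_div_log (Int.natAbs_ne_zero.2 h0.ne')).trans ?_
    have h2 : ((m.natAbs : ℕ) : ℝ) = m := by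
      rw [Nat.cast_natAbs, abs_of_pos h0]
    rw [h2]
    have : (0 : ℝ) < m := by exact_mod_cast h0
    gcongr
  have hnn : 0 ≤ log (2 * u + D) / log 2 := div_nonneg (log_nonneg (by linarith)) hlog2.le
  calc _ ≤ (((J.biUnion fun m => m.natAbs.primeFactors).card : ℕ) : ℝ) := by
        exact_mod_cast Finset.card_le_card hsub
    _ ≤ ∑ m ∈ J, ((m.natAbs.primeFactors.card : ℕ) : ℝ) := by
        exact_mod_cast Finset.card_biUnion_le
    _ ≤ ∑ m ∈ J, log (2 * u + D) / log 2 := Finset.sum_le_sum hb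
    _ = J.card * (log (2 * u + D) / log 2) := by rw [Finset.sum_const, nsmul_eq_mul]
    _ ≤ _ := by gcongr

/-- Only the primes `p` with `2u/p` at distance at least `δ` from the integers are kept; each of
their factors is at most `exp(-2δ²)`, and all others are bounded by 1. -/
theorem abs_cosPartialProd_le_exp {M : ℕ} {u δ : ℝ} (hδ : 0 < δ) (hu1 : 1 ≤ u)
    (hu : δ * M < 2 * u) :
    |cosPartialProd M u| ≤ exp (-2 * δ ^ 2 * (Nat.primeCounting M -
      (2 * (δ * M) + 1) * (log (2 * u + δ * M) / log 2))) := by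
  set Q := (Nat.primesLE M).filter fun p : ℕ => ¬ |2 * u / p - round (2 * u / p)| < δ with hQ
  have hcard : (Nat.primeCounting M : ℝ) -
      (2 * (δ * M) + 1) * (log (2 * u + δ * M) / log 2) ≤ Q.card := by
    have h1 := Finset.card_filter_add_card_filter_not (s := Nat.primesLE M)
      (fun p : ℕ => |2 * u / p - round (2 * u / p)| < δ)
    have h2 := card_primes_near_integer_le hδ hu1 hu
    have h3 : (Nat.primesLE M).card = Nat.primeCounting M := by
      simp
    rw [h3] at h1
    rw [← h1, Nat.cast_add]; linarith
  have hprod : cosPartialProd M u = ∏ n ∈ Finset.Icc 1 M, cos (π * (2 * u / (n : ℕ))) := by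
    have h := Finset.prod_Ico_add' (fun n : ℕ => cos (π * (2 * u / (n : ℕ)))) 0 M 1
    rw [zero_add, Finset.Ico_add_one_right_eq_Icc] at h
    rw [cosPartialProd, ← h, Finset.range_eq_Ico]
    refine Finset.prod_congr rfl fun k _ => ?_
    push_cast
    congr 1
    ring
  have hsub : Q ⊆ Finset.Icc 1 M := by
    intro p hp
    rw [hQ, Finset.mem_filter, Nat.mem_primesLE] at hp
    exact Finset.mem_Icc.2 ⟨hp.1.2.one_lt.le, hp.1.1⟩
  calc |cosPartialProd M u| = ∏ n ∈ Finset.Icc 1 M, |cos (π * (2 * u / (n : ℕ)))| := by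
        rw [hprod, Finset.abs_prod]
    _ ≤ ∏ n ∈ Q, |cos (π * (2 * u / (n : ℕ)))| :=
        Finset.prod_le_prod_of_subset_of_le_one hsub (fun _ _ => abs_nonneg _)
          fun _ _ _ => abs_cos_le_one _
    _ ≤ ∏ n ∈ Q, exp (-2 * δ ^ 2) := by
        apply Finset.prod_le_prod (fun _ _ => abs_nonneg _)
        intro p hp
        rw [hQ, Finset.mem_filter, not_lt] at hp
        refine (abs_cos_pi_mul_le _).trans (exp_le_exp.2 ?_)
        have := pow_le_pow_left₀ hδ.le hp.2 2
        rw [sq_abs] at this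
        linarith
    _ = exp (-2 * δ ^ 2 * Q.card) := by
        rw [Finset.prod_const, ← exp_nat_mul]; ring_nf
    _ ≤ _ := by
        apply exp_le_exp.2
        have : 0 ≤ δ ^ 2 := by positivity
        nlinarith

theorem eventually_rpow_le_primeCounting :
    ∀ᶠ M : ℕ in atTop, (M : ℝ) ^ (9 / 10 : ℝ) ≤ Nat.primeCounting M := by
  have h1 := (isLittleO_log_rpow_atTop (r := 1 / 20) (by norm_num)).bound (c := 1) one_pos
  have h2 := tendsto_rpow_atTop (y := 1 / 20) (by norm_num)
  filter_upwards [tendsto_natCast_atTop_atTop.eventually h1,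
    (h2.comp tendsto_natCast_atTop_atTop).eventually_ge_atTop 10, eventually_ge_atTop 3]
    with M hM hM2 hM3
  have hM3' : (3 : ℝ) ≤ M := by exact_mod_cast hM3
  have hM0 : (0 : ℝ) < M := by linarith
  have hlog : 0 < log M := log_pos (by linarith)
  refine le_trans ?_ (Chebyshev.pi_ge M)
  rw [le_div_iff₀ hlog]
  simp only [one_mul, Function.comp] at hM hM2
  rw [norm_of_nonneg hlog.le, norm_of_nonneg (by positivity)] at hM
  set y := (M : ℝ) ^ (1 / 20 : ℝ) with hy
  set z := (M : ℝ) ^ (9 / 10 : ℝ) with hz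
  have hzy : z * y * y = M := by
    rw [hz, hy, ← rpow_add hM0, ← rpow_add hM0]; norm_num
  have hz1 : 1 ≤ z := one_le_rpow (by linarith) (by norm_num)
  have h3 : log (M + 1) ≤ 2 * log M := by
    rw [show (2 : ℝ) * log M = log (M ^ 2) by rw [log_pow]; norm_num]
    apply log_le_log <;> nlinarith
  have h4 := log_two_gt_d9
  have h5 : z * log M ≤ z * y := by gcongr
  have h6 : z * y * 10 ≤ M := by rw [← hzy]; gcongr
  have h7 : y ≤ z * y := by nlinarith
  nlinarith

/-- With `δ = M^(-3/10)` the bad primes number about `M^(7/10)` up to powers of `log M`, against at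
least `M^(9/10)` primes in all. The saving in the exponent, about `δ² M^(9/10) = M^(3/10)`, beats `2
log u ≤ 2C log² M`. -/
theorem exists_abs_cosPartialProd_le (C : ℝ) : ∃ M₀ : ℕ, 1 ≤ M₀ ∧ ∀ M : ℕ, M₀ ≤ M → ∀ u : ℝ,
    (M : ℝ) ≤ u → u ≤ exp (C * log M ^ 2) → |cosPartialProd M u| ≤ 1 / u ^ 2 := by
  have h1 := (isLittleO_log_rpow_atTop (r := 1 / 80) (by norm_num)).bound (c := 1) one_pos
  have h2 := tendsto_rpow_atTop (y := 1 / 40) (by norm_num)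
  obtain ⟨M₀, hM₀⟩ := eventually_atTop.1 (eventually_rpow_le_primeCounting.and <|
    (tendsto_natCast_atTop_atTop.eventually h1).and <|
    ((h2.comp tendsto_natCast_atTop_atTop).eventually_ge_atTop (2 * |C| + 10)).and
    (eventually_ge_atTop 3))
  refine ⟨max 1 M₀, le_max_left _ _, fun M hM u hMu hu => ?_⟩
  obtain ⟨hπ, hlogM, hM2, hM3⟩ := hM₀ M ((le_max_right _ _).trans hM)
  have hM3' : (3 : ℝ) ≤ M := by exact_mod_cast hM3
  have hM0 : (0 : ℝ) < M := by linarith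
  have hM1 : (1 : ℝ) ≤ M := by linarith
  have hu0 : 0 < u := by linarith
  have hlog : 0 < log M := log_pos (by linarith)
  simp only [one_mul, Function.comp] at hlogM hM2
  rw [norm_of_nonneg hlog.le, norm_of_nonneg (by positivity)] at hlogM
  -- In this unit every quantity is an integral power: `M = y^40`, `δM = y^28`, `δ² = y^(-24)`,
  -- `π(M) ≥ y^36`; moreover `log² M ≤ y`.
  set y := (M : ℝ) ^ (1 / 40 : ℝ) with hy
  have hyp : ∀ k : ℕ, y ^ k = (M : ℝ) ^ ((k : ℝ) / 40) := by
    intro k; rw [hy, ← rpow_natCast, ← rpow_mul hM0.le]; ring_nf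
  have hlog2 : log M ^ 2 ≤ y := by
    calc log M ^ 2 ≤ ((M : ℝ) ^ (1 / 80 : ℝ)) ^ 2 := by gcongr
      _ = y := by rw [hy, ← rpow_natCast, ← rpow_mul hM0.le]; norm_num
  have hC := abs_nonneg C
  have hy10 : 10 ≤ y := by linarith
  have hlogu : log u ≤ |C| * y := by
    rw [← log_exp (|C| * y)]
    apply log_le_log hu0 (hu.trans (exp_le_exp.2 _))
    calc C * log M ^ 2 ≤ |C| * log M ^ 2 := by gcongr; exact le_abs_self C
      _ ≤ _ := by gcongr
  set δ : ℝ := (M : ℝ) ^ (-(3 / 10) : ℝ) with hδ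
  have hδ0 : 0 < δ := by positivity
  have hδM : δ * M = y ^ 28 := by
    rw [hyp, hδ]; nth_rewrite 2 [← rpow_one (M : ℝ)]; rw [← rpow_add hM0]; norm_num
  have hδ2 : δ ^ 2 * y ^ 24 = 1 := by
    rw [hyp, hδ, ← rpow_natCast, ← rpow_mul hM0.le, ← rpow_add hM0]; norm_num
  have hyM : y ^ 40 = M := by rw [hyp]; norm_num
  have hyle : y ^ 28 ≤ M := by rw [← hyM]; gcongr <;> linarith
  have hmain := abs_cosPartialProd_le_exp (M := M) (u := u) hδ0 (by linarith) (by rw [hδM]; linarith)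
  refine hmain.trans ?_
  rw [hδM]
  have hπ' : y ^ 36 ≤ Nat.primeCounting M := by
    rw [hyp]; convert hπ using 2; norm_num
  have hL : log (2 * u + y ^ 28) / log 2 ≤ y * y := by
    rw [div_le_iff₀ (log_pos one_lt_two)]
    have h3 : log (2 * u + y ^ 28) ≤ log (3 * u) := by
      apply log_le_log (by positivity); linarith
    rw [log_mul (by norm_num) hu0.ne'] at h3
    have h4 : log 3 ≤ 2 := by
      have := log_le_sub_one_of_pos (x := 3) (by norm_num); linarith
    have := log_two_gt_d9
    nlinarith
  have hkey : y ^ 36 / 2 ≤ Nat.primeCounting M -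
      (2 * (y ^ 28) + 1) * (log (2 * u + y ^ 28) / log 2) := by
    have h5 : (2 * (y ^ 28) + 1) * (log (2 * u + y ^ 28) / log 2) ≤ (3 * y ^ 28) * (y * y) := by
      have : 1 ≤ y ^ 28 := one_le_pow₀ (by linarith)
      refine mul_le_mul (by linarith) hL ?_ (by positivity)
      exact div_nonneg (log_nonneg (by linarith)) (log_nonneg one_le_two)
    have h6 : 10 * y ^ 30 ≤ y ^ 36 := by
      calc 10 * y ^ 30 ≤ y ^ 6 * y ^ 30 := by
            gcongr
            calc (10 : ℝ) ≤ y := hy10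
              _ ≤ y ^ 6 := le_self_pow₀ (by linarith) (by norm_num)
        _ = y ^ 36 := by ring
    nlinarith [h5, h6, hπ']
  have hfin : 1 / u ^ 2 = exp (-2 * log u) := by
    rw [show -2 * log u = -(log (u ^ 2)) by rw [log_pow]; push_cast; ring, exp_neg,
      exp_log (by positivity), one_div]
  rw [hfin]
  apply exp_le_exp.2
  have h7 : y ^ 12 ≤ 2 * δ ^ 2 * (Nat.primeCounting M -
      (2 * (y ^ 28) + 1) * (log (2 * u + y ^ 28) / log 2)) := by
    calc y ^ 12 = δ ^ 2 * y ^ 24 * y ^ 12 := by rw [hδ2, one_mul]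
      _ = 2 * δ ^ 2 * (y ^ 36 / 2) := by ring
      _ ≤ _ := by gcongr
  have h8 : 2 * log u ≤ y ^ 12 := by
    calc 2 * log u ≤ 2 * |C| * y := by linarith
      _ ≤ y * y := by gcongr; linarith
      _ = y ^ 2 := by ring
      _ ≤ y ^ 12 := by gcongr <;> linarith
  linarith

/-- Decay of the partial products, uniform in `N`, up to height `exp (C (log N) ^ 2)`. -/
theorem exists_abs_cosPartialProd_le_of_le (C : ℝ) : ∃ M₀ : ℕ, 1 ≤ M₀ ∧ ∀ N : ℕ, M₀ ≤ N →
    ∀ u : ℝ, (M₀ : ℝ) ≤ u → u ≤ exp (C * log N ^ 2) → |cosPartialProd N u| ≤ 1 / u ^ 2 := by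
  -- The 2 serves the range `u ≤ N`: there the product is cut to `M = ⌊u⌋` factors, and `u ≤ M² ≤
  -- exp(2 log² M)` once `M ≥ 3 > e`.
  obtain ⟨M₀, hM₀, h⟩ := exists_abs_cosPartialProd_le (max C 2)
  refine ⟨max M₀ 3, le_max_of_le_left hM₀, fun N hN u hu1 hu2 => ?_⟩
  rcases le_total (N : ℝ) u with hNu | hNu
  · refine h N ((le_max_left _ _).trans hN) u hNu (hu2.trans (exp_le_exp.2 ?_))
    gcongr
    exact le_max_left _ _
  · have hu3 : max M₀ 3 ≤ ⌊u⌋₊ := Nat.le_floor hu1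
    have hu4 : (3 : ℝ) ≤ u := le_trans (by exact_mod_cast le_max_right M₀ 3) hu1
    have hfl : ⌊u⌋₊ ≤ N := Nat.floor_le_of_le hNu
    have hfu : (⌊u⌋₊ : ℝ) ≤ u := Nat.floor_le (by linarith)
    refine (abs_cosPartialProd_anti hfl u).trans
      (h _ ((le_max_left _ _).trans hu3) u hfu ?_)
    have hfl3 : (3 : ℝ) ≤ ⌊u⌋₊ := by exact_mod_cast (le_max_right M₀ 3).trans hu3
    have hlog1 : 1 ≤ log ⌊u⌋₊ := by
      rw [le_log_iff_exp_le (by linarith)]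
      linarith [exp_one_lt_d9]
    rw [← log_le_iff_le_exp (by linarith)]
    calc log u ≤ log ((⌊u⌋₊ : ℝ) ^ 2) := by
          apply log_le_log (by linarith)
          nlinarith [Nat.lt_floor_add_one u]
      _ = 2 * log ⌊u⌋₊ := by rw [log_pow]; norm_num
      _ ≤ 2 * log ⌊u⌋₊ ^ 2 := by nlinarith
      _ ≤ max C 2 * log ⌊u⌋₊ ^ 2 := by gcongr; exact le_max_right _ _

/-! ### The infinite product and the limiting density. -/

theorem multipliable_cos_div (u : ℝ) :
    Multipliable fun k : ℕ => cos (2 * π * u / ((k : ℝ) + 1)) := by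
  have h : Summable fun k : ℕ => ‖cos (2 * π * u / ((k : ℝ) + 1)) - 1‖ := by
    have h1 : Summable fun k : ℕ => (2 * π * u) ^ 2 / 2 * (1 / ((k + 1 : ℕ) : ℝ) ^ 2) :=
      ((summable_nat_add_iff 1).2 (Real.summable_one_div_nat_pow.2 one_lt_two)).mul_left _
    refine Summable.of_nonneg_of_le (fun _ => norm_nonneg _) (fun k => ?_) h1
    rw [norm_eq_abs, abs_sub_comm, abs_of_nonneg (sub_nonneg.2 (cos_le_one _))]
    have h2 := one_sub_sq_div_two_le_cos (x := 2 * π * u / ((k : ℝ) + 1))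
    have h3 : (2 * π * u) ^ 2 / 2 * (1 / ((k + 1 : ℕ) : ℝ) ^ 2) =
        (2 * π * u / ((k : ℝ) + 1)) ^ 2 / 2 := by
      push_cast; field_simp
    rw [h3]; linarith
  simpa using multipliable_one_add_of_summable h

theorem tendsto_cosPartialProd (u : ℝ) :
    Tendsto (fun N => cosPartialProd N u) atTop (𝓝 (cosProd u)) :=
  (multipliable_cos_div u).hasProd.tendsto_prod_nat

theorem continuous_cosPartialProd (N : ℕ) : Continuous (cosPartialProd N) := by
  unfold cosPartialProd; fun_prop

theorem measurable_cosProd : Measurable cosProd :=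
  measurable_of_tendsto_metrizable (fun N => (continuous_cosPartialProd N).measurable)
    (tendsto_pi_nhds.2 tendsto_cosPartialProd)

theorem tendsto_exp_mul_log_sq {C : ℝ} (hC : 0 < C) :
    Tendsto (fun N : ℕ => exp (C * log N ^ 2)) atTop atTop :=
  tendsto_exp_atTop.comp <| ((tendsto_pow_atTop two_ne_zero).comp
    (tendsto_log_atTop.comp tendsto_natCast_atTop_atTop)).const_mul_atTop hC

theorem exists_abs_cosPartialProd_le_inv_one_add_sq (C : ℝ) :
    ∃ K : ℝ, 0 < K ∧ ∀ᶠ N : ℕ in atTop, ∀ u : ℝ, 0 ≤ u → u ≤ exp (C * log N ^ 2) →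
      |cosPartialProd N u| ≤ K * (1 + u ^ 2)⁻¹ := by
  obtain ⟨M₀, h1, h⟩ := exists_abs_cosPartialProd_le_of_le C
  have h1' : (1 : ℝ) ≤ M₀ := by exact_mod_cast h1
  refine ⟨1 + (M₀ : ℝ) ^ 2, by positivity, ?_⟩
  filter_upwards [eventually_ge_atTop M₀] with N hN u hu0 hu
  rw [← div_eq_mul_inv]
  rcases le_total (M₀ : ℝ) u with hM | hM
  · refine (h N hN u hM hu).trans ?_
    have hu1 : 1 ≤ u ^ 2 := one_le_pow₀ (h1'.trans hM)
    rw [div_le_div_iff₀ (by positivity) (by positivity)]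
    nlinarith
  · refine (abs_cosPartialProd_le_one N u).trans ?_
    rw [one_le_div (by positivity)]
    gcongr

/-- Each fixed `u` eventually lies below `exp(log² N)`, so the bound, uniform in `N`, passes to the
limit. -/
theorem exists_abs_cosProd_le_inv_one_add_sq :
    ∃ K : ℝ, 0 < K ∧ ∀ u : ℝ, 0 ≤ u → |cosProd u| ≤ K * (1 + u ^ 2)⁻¹ := by
  obtain ⟨K, hK, h⟩ := exists_abs_cosPartialProd_le_inv_one_add_sq 1
  refine ⟨K, hK, fun u hu => le_of_tendsto (tendsto_cosPartialProd u).abs ?_⟩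
  filter_upwards [h, (tendsto_exp_mul_log_sq one_pos).eventually_ge_atTop u] with N hN hN'
  exact hN u hu hN'

theorem integrableOn_cosProd : IntegrableOn cosProd (Set.Ioi 0) := by
  obtain ⟨K, -, hK⟩ := exists_abs_cosProd_le_inv_one_add_sq
  refine Integrable.mono' (integrable_inv_one_add_sq.const_mul K).integrableOn
    measurable_cosProd.aestronglyMeasurable ?_
  filter_upwards [ae_restrict_mem measurableSet_Ioi] with u hu
  exact hK u (le_of_lt hu)

theorem integrableOn_cos_mul_cosProd (x : ℝ) :
    IntegrableOn (fun u : ℝ => cos (2 * π * u * x) * cosProd u) (Set.Ioi 0) :=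
  integrableOn_cosProd.bdd_mul (c := 1)
    (by fun_prop : Continuous fun u : ℝ => cos (2 * π * u * x)).aestronglyMeasurable
    (Eventually.of_forall fun _ => abs_cos_le_one _)

theorem continuous_limitDensity : Continuous limitDensity := by
  unfold limitDensity
  refine continuous_const.mul (continuous_of_dominated
    (fun x => (integrableOn_cos_mul_cosProd x).aestronglyMeasurable)
    (fun x => Eventually.of_forall fun u => ?_) integrableOn_cosProd.norm
    (Eventually.of_forall fun u => by fun_prop))
  rw [norm_mul]
  exact mul_le_of_le_one_left (norm_nonneg _) (abs_cos_le_one _)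

theorem exists_abs_limitDensity_le : ∃ B : ℝ, 0 < B ∧ ∀ x, |limitDensity x| ≤ B := by
  refine ⟨2 * (∫ u in Set.Ioi 0, ‖cosProd u‖) + 1, by positivity, fun x => ?_⟩
  rw [limitDensity, abs_mul, abs_two]
  have : |∫ u in Set.Ioi (0 : ℝ), cos (2 * π * u * x) * cosProd u| ≤
      ∫ u in Set.Ioi 0, ‖cosProd u‖ := by
    rw [← norm_eq_abs]
    refine norm_integral_le_of_norm_le integrableOn_cosProd.norm
      (Eventually.of_forall fun u => ?_)
    rw [norm_mul]
    exact mul_le_of_le_one_left (norm_nonneg _) (abs_cos_le_one _)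
  linarith

/-- Dominated convergence, the growing cutoff being absorbed into an indicator: the quadratic bound
holds uniformly in `N` exactly on the range of integration. -/
theorem tendsto_integral_abs_cosPartialProd_sub (C : ℝ) :
    Tendsto (fun N : ℕ => ∫ u in Set.Ioc 0 (exp (C * log N ^ 2)),
      |cosPartialProd N u - cosProd u|) atTop (𝓝 0) := by
  obtain ⟨K, hK0, hK⟩ := exists_abs_cosPartialProd_le_inv_one_add_sq C
  obtain ⟨K', hK0', hK'⟩ := exists_abs_cosProd_le_inv_one_add_sq
  simp_rw [← integral_indicator (measurableSet_Ioc (α := ℝ))]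
  have h0 : (0 : ℝ) = ∫ _ : ℝ, (0 : ℝ) := by simp
  nth_rewrite 2 [h0]
  refine tendsto_integral_filter_of_dominated_convergence
    (fun u => (K + K') * (1 + u ^ 2)⁻¹) (Eventually.of_forall fun N => ?_) ?_
    (integrable_inv_one_add_sq.const_mul _) (Eventually.of_forall fun u => ?_)
  · exact (((continuous_cosPartialProd N).measurable.sub measurable_cosProd).abs.indicator
      measurableSet_Ioc).aestronglyMeasurable
  · filter_upwards [hK] with N hN
    refine Eventually.of_forall fun u => ?_
    rw [norm_indicator_eq_indicator_norm]
    by_cases hu : u ∈ Set.Ioc 0 (exp (C * log N ^ 2))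
    swap
    · rw [Set.indicator_of_notMem hu]; positivity
    rw [Set.indicator_of_mem hu, norm_eq_abs, abs_abs]
    have h1 := hN u hu.1.le hu.2
    have h2 := hK' u hu.1.le
    have h3 := abs_sub (cosPartialProd N u) (cosProd u)
    linarith
  · have h : Tendsto (fun N => |cosPartialProd N u - cosProd u|) atTop (𝓝 0) := by
      have := ((tendsto_cosPartialProd u).sub_const (cosProd u)).abs
      simpa using this
    refine squeeze_zero (fun N => Set.indicator_nonneg (fun _ _ => abs_nonneg _) u)
      (fun N => Set.indicator_le_self' (fun _ _ => abs_nonneg _) u) h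

/-! ### The tent function and its Fourier transform. -/

/-- The tent function `max (1 - |x|) 0`. -/
noncomputable def tent (x : ℝ) : ℝ := max (1 - |x|) 0

/-- The Fourier transform of the tent function, as a cosine transform. -/
noncomputable def tentTransform (u : ℝ) : ℝ := ∫ x, cos (2 * π * u * x) * tent x

theorem continuous_tent : Continuous tent := by unfold tent; fun_prop

theorem tent_nonneg (x : ℝ) : 0 ≤ tent x := le_max_right _ _

theorem tent_le_one (x : ℝ) : tent x ≤ 1 :=
  max_le (by linarith [abs_nonneg x]) zero_le_one

theorem tent_eq_zero {x : ℝ} (hx : 1 ≤ |x|) : tent x = 0 := max_eq_right (by linarith)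

theorem hasCompactSupport_tent : HasCompactSupport tent :=
  HasCompactSupport.of_support_subset_isCompact (isCompact_Icc (a := -1) (b := 1)) fun x hx => by
    by_contra h
    refine hx (tent_eq_zero ?_)
    rw [Set.mem_Icc, ← abs_le, not_le] at h
    exact h.le

theorem integrable_tent : Integrable tent :=
  continuous_tent.integrable_of_hasCompactSupport hasCompactSupport_tent

theorem integral_tent_mul (f : ℝ → ℝ) (hf : ∀ x, f |x| = f x) :
    ∫ x, f x * tent x = 2 * ∫ x in (0 : ℝ)..1, f x * (1 - x) := by
  have h1 : ∀ x, f x * tent x = (fun y => f y * tent y) |x| := by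
    intro x; simp [hf, tent]
  rw [funext h1, integral_comp_abs (f := fun y => f y * tent y)]
  congr 1
  rw [intervalIntegral.integral_of_le zero_le_one]
  have h2 : ∫ x in Set.Ioi (0 : ℝ), f x * tent x = ∫ x in Set.Ioc (0 : ℝ) 1, f x * tent x := by
    refine (setIntegral_eq_of_subset_of_forall_sdiff_eq_zero measurableSet_Ioi
      Set.Ioc_subset_Ioi_self fun x hx => ?_)
    have h3 : (0 : ℝ) < x := hx.1
    have h4 : 1 ≤ |x| := by
      rw [abs_of_pos h3]
      by_contra h
      exact hx.2 ⟨h3, (not_le.1 h).le⟩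
    rw [tent_eq_zero h4, mul_zero]
  rw [h2]
  refine setIntegral_congr_fun measurableSet_Ioc fun x hx => ?_
  simp only [tent]
  rw [abs_of_pos hx.1, max_eq_left (by linarith [hx.2])]

theorem integral_tent : ∫ x, tent x = 1 := by
  have h := integral_tent_mul (fun _ => 1) (fun _ => rfl)
  simp only [one_mul] at h
  rw [h, intervalIntegral.integral_sub (by simp) (by simp)]
  norm_num

theorem integrable_cos_mul_tent (u : ℝ) : Integrable fun x => cos (2 * π * u * x) * tent x :=
  integrable_tent.bdd_mul (c := 1)
    (by fun_prop : Continuous fun x : ℝ => cos (2 * π * u * x)).aestronglyMeasurable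
    (Eventually.of_forall fun _ => abs_cos_le_one _)

theorem abs_tentTransform_le_one (u : ℝ) : |tentTransform u| ≤ 1 := by
  rw [← integral_tent, tentTransform, ← norm_eq_abs]
  refine norm_integral_le_of_norm_le integrable_tent (Eventually.of_forall fun x => ?_)
  rw [norm_mul, norm_of_nonneg (tent_nonneg x)]
  exact mul_le_of_le_one_left (tent_nonneg x) (abs_cos_le_one _)

theorem continuous_tentTransform : Continuous tentTransform := by
  unfold tentTransform
  refine continuous_of_dominated (fun u => (integrable_cos_mul_tent u).aestronglyMeasurable)
    (fun u => Eventually.of_forall fun x => ?_) integrable_tent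
    (Eventually.of_forall fun x => by fun_prop)
  rw [norm_mul, norm_of_nonneg (tent_nonneg x)]
  exact mul_le_of_le_one_left (tent_nonneg x) (abs_cos_le_one _)

theorem tentTransform_neg (u : ℝ) : tentTransform (-u) = tentTransform u := by
  simp [tentTransform]

theorem tentTransform_abs (u : ℝ) : tentTransform |u| = tentTransform u := by
  rcases abs_choice u with h | h <;> rw [h]
  exact tentTransform_neg u

theorem tentTransform_eq {u : ℝ} (hu : u ≠ 0) :
    tentTransform u = 2 * (1 - cos (2 * π * u)) / (2 * π * u) ^ 2 := by
  have hw : 2 * π * u ≠ 0 := by have := pi_pos; positivity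
  rw [tentTransform, integral_tent_mul]
  · set w := 2 * π * u
    have hd : ∀ x ∈ Set.uIcc (0 : ℝ) 1, HasDerivAt
        (fun x => (1 - x) * (sin (w * x) / w) - cos (w * x) / w ^ 2)
        (cos (w * x) * (1 - x)) x := by
      intro x _
      have h1 : HasDerivAt (fun x => w * x) w x := by
        simpa using (hasDerivAt_id x).const_mul w
      have h2 := (((hasDerivAt_id x).const_sub 1).mul (h1.sin.div_const w)).sub
        (h1.cos.div_const (w ^ 2))
      refine h2.congr_deriv ?_
      simp only [id]
      field_simp
      ring
    rw [intervalIntegral.integral_eq_sub_of_hasDerivAt hd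
      (by apply Continuous.intervalIntegrable; fun_prop)]
    simp
    field_simp
    ring
  · intro x
    rcases abs_choice x with h | h <;> rw [h]
    simp

/-- This quadratic decay is the reason for using tents: the transform of an interval's indicator is
only of order `1/u`, which is not integrable. -/
theorem abs_tentTransform_le {u : ℝ} (hu : u ≠ 0) : |tentTransform u| ≤ 1 / u ^ 2 := by
  rw [tentTransform_eq hu, abs_div, abs_of_pos (by have := pi_pos; positivity : 0 < (2 * π * u) ^ 2),
    div_le_div_iff₀ (by have := pi_pos; positivity) (by positivity)]
  have h1 := neg_one_le_cos (2 * π * u)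
  have h2 := cos_le_one (2 * π * u)
  rw [abs_of_nonneg (by linarith)]
  have h3 : 0 ≤ u ^ 2 := by positivity
  have h4 := pi_gt_three
  calc 2 * (1 - cos (2 * π * u)) * u ^ 2 ≤ 4 * u ^ 2 := by nlinarith
    _ ≤ 1 * (2 * π * u) ^ 2 := by
      have : 4 ≤ 4 * π ^ 2 := by nlinarith
      nlinarith

theorem integrable_tentTransform : Integrable tentTransform := by
  refine Integrable.mono' (integrable_inv_one_add_sq.const_mul 2)
    continuous_tentTransform.aestronglyMeasurable (Eventually.of_forall fun u => ?_)
  rw [norm_eq_abs, ← div_eq_mul_inv, le_div_iff₀ (by positivity)]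
  have h1 := abs_tentTransform_le_one u
  rcases eq_or_ne u 0 with rfl | hu
  · nlinarith
  have h2 := abs_tentTransform_le hu
  rw [le_div_iff₀ (by positivity)] at h2
  linarith

theorem integral_exp_mul_even {f : ℝ → ℝ} (hf : Integrable f) (heven : ∀ x, f (-x) = f x) (a : ℝ) :
    ∫ x, Complex.exp ((a * x : ℝ) * Complex.I) • (f x : ℂ) =
      ((∫ x, cos (a * x) * f x : ℝ) : ℂ) := by
  have hc : Integrable fun x => cos (a * x) * f x := hf.bdd_mul (c := 1)
    (by fun_prop : Continuous fun x : ℝ => cos (a * x)).aestronglyMeasurable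
    (Eventually.of_forall fun _ => abs_cos_le_one _)
  have hs : Integrable fun x => sin (a * x) * f x := hf.bdd_mul (c := 1)
    (by fun_prop : Continuous fun x : ℝ => sin (a * x)).aestronglyMeasurable
    (Eventually.of_forall fun _ => abs_sin_le_one _)
  have hs0 : ∫ x, sin (a * x) * f x = 0 := by
    have h := integral_neg_eq_self (fun x => sin (a * x) * f x) volume
    simp only [mul_neg, sin_neg, heven, neg_mul, integral_neg] at h
    linarith
  have h1 : ∀ x : ℝ, Complex.exp ((a * x : ℝ) * Complex.I) • (f x : ℂ) =
      ((cos (a * x) * f x : ℝ) : ℂ) + ((sin (a * x) * f x : ℝ) : ℂ) * Complex.I := by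
    intro x
    rw [Complex.exp_mul_I, smul_eq_mul]
    push_cast
    ring
  simp_rw [h1]
  rw [integral_add hc.ofReal (hs.ofReal.mul_const _), integral_mul_const, integral_complex_ofReal,
    integral_complex_ofReal, hs0]
  simp

theorem fourier_tent :
    FourierTransform.fourier (fun x => (tent x : ℂ)) = fun u => (tentTransform u : ℂ) := by
  ext u
  have h := integral_exp_mul_even integrable_tent (fun x => by simp [tent]) (-(2 * π * u))
  rw [Real.fourier_real_eq_integral_exp_smul, tentTransform]
  simp only [neg_mul, cos_neg] at h
  rw [← h]
  refine integral_congr_ae (Eventually.of_forall fun x => ?_)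
  ring_nf

/-- Fourier inversion for the tent function. -/
theorem tent_eq_integral (y : ℝ) :
    tent y = 2 * ∫ u in Set.Ioi (0 : ℝ), cos (2 * π * u * y) * tentTransform u := by
  have h := Continuous.fourierInv_fourier_eq (f := fun x => (tent x : ℂ))
    (Complex.continuous_ofReal.comp continuous_tent) integrable_tent.ofReal
    (by rw [fourier_tent]; exact integrable_tentTransform.ofReal)
  have h1 := congrFun h y
  rw [fourier_tent, Real.fourierInv_eq'] at h1
  have h2 := integral_exp_mul_even integrable_tentTransform tentTransform_neg (2 * π * y)
  have h3 : tent y = ∫ u, cos (2 * π * y * u) * tentTransform u := by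
    have h4 := h1.symm.trans (Eq.trans ?_ h2)
    · exact_mod_cast h4
    · refine integral_congr_ae (Eventually.of_forall fun u => ?_)
      beta_reduce
      rw [show inner ℝ u y = u * y by simp [mul_comm]]
      ring_nf
  have h5 : ∀ u, cos (2 * π * y * u) * tentTransform u =
      (fun v => cos (2 * π * v * y) * tentTransform v) |u| := by
    intro u
    simp only [tentTransform_abs]
    congr 1
    rcases abs_choice u with h | h <;> rw [h]
    · ring_nf
    · rw [← cos_neg]; ring_nf
  rw [h3, funext h5, integral_comp_abs (f := fun v => cos (2 * π * v * y) * tentTransform v)]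

/-! ### Characteristic function of the signed harmonic sum. -/

theorem integral_uniformOn_neg_one_one (f : ℝ → ℂ) :
    ∫ x, f x ∂(uniformOn ({-1, 1} : Set ℝ)) = (f (-1) + f 1) / 2 := by
  have hs : ({-1, 1} : Set ℝ) = (({-1, 1} : Finset ℝ) : Set ℝ) := by simp
  have hcard : ({-1, 1} : Finset ℝ).card = 2 := Finset.card_pair (by norm_num)
  rw [uniformOn, ProbabilityTheory.cond, integral_smul_measure, hs,
    setIntegral_finset, Measure.count_apply_finset, hcard]
  · rw [Finset.sum_pair (by norm_num)]
    simp [Measure.real]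
    ring
  · rw [← hs, Set.insert_eq, integrableOn_union]
    simp

theorem integral_exp_sign {Ω : Type*} [MeasurableSpace Ω] {P : Measure Ω} {s : Ω → ℝ}
    (hs : HasLaw s (uniformOn ({-1, 1} : Set ℝ)) P) (t : ℝ) :
    ∫ ω, Complex.exp ((t * s ω : ℝ) * Complex.I) ∂P = (cos t : ℂ) := by
  have h := hs.integral_comp (f := fun x : ℝ => Complex.exp ((t * x : ℝ) * Complex.I))
    (by fun_prop : Continuous fun x : ℝ =>
      Complex.exp ((t * x : ℝ) * Complex.I)).aestronglyMeasurable
  simp only [Function.comp_def] at h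
  rw [h, integral_uniformOn_neg_one_one, Complex.ofReal_cos, Complex.cos]
  push_cast
  ring_nf

theorem integral_exp_signedHarmonicSum {Ω : Type*} [MeasurableSpace Ω] {P : Measure Ω} {N : ℕ}
    {s : Fin N → Ω → ℝ} (hs : ∀ i, HasLaw (s i) (uniformOn ({-1, 1} : Set ℝ)) P)
    (hind : iIndepFun s P) (u : ℝ) :
    ∫ ω, Complex.exp ((2 * π * u * signedHarmonicSum N s ω : ℝ) * Complex.I) ∂P =
      (cosPartialProd N u : ℂ) := by
  have h1 : ∀ ω, Complex.exp ((2 * π * u * signedHarmonicSum N s ω : ℝ) * Complex.I) =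
      ∏ i : Fin N, Complex.exp (((2 * π * u / ((i : ℝ) + 1)) * s i ω : ℝ) * Complex.I) := by
    intro ω
    rw [← Complex.exp_sum, ← Finset.sum_mul, ← Complex.ofReal_sum, signedHarmonicSum,
      Finset.mul_sum]
    congr 4
    ext i
    ring
  simp_rw [h1]
  rw [hind.integral_fun_prod_comp (f := fun (i : Fin N) (x : ℝ) =>
    Complex.exp (((2 * π * u / (((i : ℕ) : ℝ) + 1)) * x : ℝ) * Complex.I))
    (fun i => (hs i).aemeasurable) (fun i => by
      apply Continuous.aestronglyMeasurable; fun_prop)]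
  simp_rw [integral_exp_sign (hs _)]
  rw [Fin.prod_univ_eq_prod_range (fun k : ℕ => ((cos (2 * π * u / ((k : ℝ) + 1)) : ℝ) : ℂ)),
    cosPartialProd, Complex.ofReal_prod]

theorem aemeasurable_signedHarmonicSum {Ω : Type*} [MeasurableSpace Ω] {P : Measure Ω} {N : ℕ}
    {s : Fin N → Ω → ℝ} (hs : ∀ i, AEMeasurable (s i) P) :
    AEMeasurable (signedHarmonicSum N s) P :=
  Finset.aemeasurable_fun_sum _ fun i _ => (hs i).div_const _

/-- Since `φ` is real, the real part of `exp(-2πiuc) φ` has no sine term. -/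
theorem integral_cos_mul_sub_of_integral_exp {ν : Measure ℝ} [IsProbabilityMeasure ν] {u φ : ℝ}
    (h : ∫ x, Complex.exp ((2 * π * u * x : ℝ) * Complex.I) ∂ν = (φ : ℂ)) (c : ℝ) :
    ∫ x, cos (2 * π * u * (x - c)) ∂ν = cos (2 * π * u * c) * φ := by
  have hi : Integrable (fun x : ℝ => Complex.exp ((2 * π * u * (x - c) : ℝ) * Complex.I)) ν :=
    (integrable_const (1 : ℝ)).mono' (by apply Continuous.aestronglyMeasurable; fun_prop)
      (Eventually.of_forall fun x => by rw [Complex.norm_exp_ofReal_mul_I])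
  have h1 : ∀ x : ℝ, Complex.exp ((2 * π * u * (x - c) : ℝ) * Complex.I) =
      Complex.exp ((-(2 * π * u * c) : ℝ) * Complex.I) *
        Complex.exp ((2 * π * u * x : ℝ) * Complex.I) := by
    intro x
    rw [← Complex.exp_add]
    push_cast
    ring_nf
  have h2 := integral_re hi
  simp only [RCLike.re_to_complex, Complex.exp_ofReal_mul_I_re] at h2
  rw [h2]
  simp_rw [h1]
  rw [integral_const_mul, h, Complex.re_mul_ofReal, Complex.exp_ofReal_mul_I_re, cos_neg]

/-! ### Tents tested against the two laws. -/

/-- The mean of a rescaled tent function, by Fourier inversion. -/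
theorem integral_tent_eq {ν : Measure ℝ} [IsProbabilityMeasure ν] {φ : ℝ → ℝ}
    (hφ : ∀ u c, ∫ x, cos (2 * π * u * (x - c)) ∂ν = cos (2 * π * u * c) * φ u)
    {h : ℝ} (hh : 0 < h) (c : ℝ) :
    ∫ x, tent ((x - c) / h) ∂ν =
      2 * h * ∫ u in Set.Ioi (0 : ℝ), cos (2 * π * u * c) * φ u * tentTransform (h * u) := by
  simp_rw [tent_eq_integral]
  rw [integral_const_mul, integral_integral_swap]
  · have h1 : ∀ u : ℝ, ∫ x, cos (2 * π * u * ((x - c) / h)) * tentTransform u ∂ν =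
        cos (2 * π * (u / h) * c) * φ (u / h) * tentTransform u := by
      intro u
      rw [integral_mul_const, ← hφ]
      congr 3
      ext x
      ring_nf
    simp_rw [h1]
    have h2 := integral_comp_mul_left_Ioi
      (fun u => cos (2 * π * (u / h) * c) * φ (u / h) * tentTransform u) 0 hh
    simp only [mul_zero, mul_div_cancel_left₀ _ hh.ne', smul_eq_mul] at h2
    rw [h2, mul_assoc, mul_inv_cancel_left₀ hh.ne']
  · have h3 := (integrable_tentTransform.restrict (s := Set.Ioi 0)).comp_snd ν
    refine h3.bdd_mul (c := 1) ?_ (Eventually.of_forall fun _ => abs_cos_le_one _)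
    apply Continuous.aestronglyMeasurable
    fun_prop

theorem integral_tent_mul_cos {h : ℝ} (hh : 0 < h) (c u : ℝ) :
    ∫ x, cos (2 * π * u * x) * tent ((x - c) / h) =
      h * (cos (2 * π * u * c) * tentTransform (h * u)) := by
  have h1 := integral_sub_right_eq_self (μ := volume)
    (fun x => cos (2 * π * u * (x + c)) * tent (x / h)) c
  simp only [sub_add_cancel] at h1
  have h2 := Measure.integral_comp_div
    (fun x => cos (2 * π * u * (h * x + c)) * tent x) h
  simp only [mul_div_cancel₀ _ hh.ne', smul_eq_mul, abs_of_pos hh] at h2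
  rw [h1, h2]
  congr 1
  have h3 : ∀ x, cos (2 * π * u * (h * x + c)) * tent x =
      cos (2 * π * u * c) * (cos (2 * π * (h * u) * x) * tent x) -
        sin (2 * π * u * c) * (sin (2 * π * (h * u) * x) * tent x) := by
    intro x
    rw [show 2 * π * u * (h * x + c) = 2 * π * (h * u) * x + 2 * π * u * c by ring, cos_add]
    ring
  have hs : Integrable fun x => sin (2 * π * (h * u) * x) * tent x :=
    integrable_tent.bdd_mul (c := 1)
      (by fun_prop : Continuous fun x : ℝ => sin (2 * π * (h * u) * x)).aestronglyMeasurable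
      (Eventually.of_forall fun _ => abs_sin_le_one _)
  have hs0 : ∫ x, sin (2 * π * (h * u) * x) * tent x = 0 := by
    have h := integral_neg_eq_self (fun x => sin (2 * π * (h * u) * x) * tent x) volume
    simp only [mul_neg, sin_neg, tent, abs_neg, neg_mul, integral_neg] at h
    simp only [tent]
    linarith
  simp_rw [h3]
  rw [integral_sub ((integrable_cos_mul_tent _).const_mul _) (hs.const_mul _),
    integral_const_mul, integral_const_mul, hs0, mul_zero, sub_zero, tentTransform]

theorem integrable_tent_comp {h : ℝ} (hh : 0 < h) (c : ℝ) :
    Integrable fun x => tent ((x - c) / h) :=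
  (integrable_tent.comp_div hh.ne').comp_sub_right c

theorem integral_tent_comp {h : ℝ} (hh : 0 < h) (c : ℝ) : ∫ x, tent ((x - c) / h) = h := by
  rw [integral_sub_right_eq_self (fun x => tent (x / h)) c, Measure.integral_comp_div,
    integral_tent, abs_of_pos hh, smul_eq_mul, mul_one]

/-- The integral of a rescaled tent function against the limiting density, by Parseval. -/
theorem integral_tent_mul_limitDensity {h : ℝ} (hh : 0 < h) (c : ℝ) :
    ∫ x, tent ((x - c) / h) * limitDensity x =
      2 * h * ∫ u in Set.Ioi (0 : ℝ), cos (2 * π * u * c) * cosProd u * tentTransform (h * u) := by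
  have h1 : ∀ x, tent ((x - c) / h) * limitDensity x =
      2 * ∫ u in Set.Ioi (0 : ℝ),
        cos (2 * π * u * x) * (tent ((x - c) / h) * cosProd u) := by
    intro x
    rw [limitDensity, mul_left_comm, ← integral_const_mul]
    congr 2
    ext u
    ring
  simp_rw [h1]
  rw [integral_const_mul, integral_integral_swap]
  · have h2 : ∀ u, ∫ x, cos (2 * π * u * x) * (tent ((x - c) / h) * cosProd u) =
        h * (cos (2 * π * u * c) * cosProd u * tentTransform (h * u)) := by
      intro u
      simp_rw [← mul_assoc]
      rw [integral_mul_const, integral_tent_mul_cos hh]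
      ring
    simp_rw [h2]
    rw [integral_const_mul, mul_assoc]
  · refine ((integrable_tent_comp hh c).mul_prod integrableOn_cosProd).bdd_mul (c := 1) ?_
      (Eventually.of_forall fun _ => abs_cos_le_one _)
    apply Continuous.aestronglyMeasurable
    fun_prop

theorem integral_Ioi_one_div_sq {T : ℝ} (hT : 0 < T) :
    IntegrableOn (fun u : ℝ => 1 / u ^ 2) (Set.Ioi T) ∧ ∫ u in Set.Ioi T, 1 / u ^ 2 = 1 / T := by
  have h1 : ∀ u ∈ Set.Ioi T, u ^ (-2 : ℝ) = 1 / u ^ 2 := by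
    intro u hu
    have : 0 < u := hT.trans hu
    rw [rpow_neg this.le, one_div]
    norm_cast
  refine ⟨(integrableOn_Ioi_rpow_of_lt (by norm_num) hT).congr_fun h1 measurableSet_Ioi, ?_⟩
  rw [← setIntegral_congr_fun measurableSet_Ioi h1, integral_Ioi_rpow_of_lt (by norm_num) hT]
  norm_num
  rw [rpow_neg_one]

/-- For tent functions of width at least `exp (-C (log N) ^ 2)`, the two Fourier integrals agree
up to `o(h)`. -/
theorem eventually_integral_cosPartialProd_sub_le {C ε : ℝ} (hC : 0 < C) (hε : 0 < ε) :
    ∀ᶠ N : ℕ in atTop, ∀ h c : ℝ, exp (-C * log N ^ 2) ≤ h →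
      |2 * h * (∫ u in Set.Ioi (0 : ℝ),
          cos (2 * π * u * c) * cosPartialProd N u * tentTransform (h * u)) -
        2 * h * ∫ u in Set.Ioi (0 : ℝ),
          cos (2 * π * u * c) * cosProd u * tentTransform (h * u)| ≤ ε * h := by
  filter_upwards [(tendsto_integral_abs_cosPartialProd_sub (3 * C)).eventually_le_const
      (show (0 : ℝ) < ε / 4 by positivity),
    (tendsto_exp_mul_log_sq hC).eventually_ge_atTop (8 / ε)] with N hN1 hN2 h c hh
  have hh0 : 0 < h := (exp_pos _).trans_le hh
  -- The factor 3 makes `h²T ≥ exp(C log² N)`, so the tail beyond `T`, at most `2/(h²T)`, is below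
  -- `ε/4`. The part up to `T` is handled by the `L¹` comparison.
  set T := exp (3 * C * log N ^ 2) with hT
  have hT0 : 0 < T := exp_pos _
  have hhT : 8 / ε ≤ h ^ 2 * T := by
    calc 8 / ε ≤ exp (C * log N ^ 2) := hN2
      _ = exp (-C * log N ^ 2) ^ 2 * T := by
        rw [hT, ← exp_nat_mul, ← exp_add]; push_cast; ring_nf
      _ ≤ _ := by gcongr
  have hW : Integrable fun u => tentTransform (h * u) :=
    integrable_tentTransform.comp_mul_left' hh0.ne'
  have hint : ∀ f : ℝ → ℝ, Measurable f → (∀ u, |f u| ≤ 1) →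
      IntegrableOn (fun u => cos (2 * π * u * c) * f u * tentTransform (h * u)) (Set.Ioi 0) := by
    intro f hf hf1
    refine hW.integrableOn.bdd_mul (c := 1) (by fun_prop) (Eventually.of_forall fun u => ?_)
    rw [norm_mul]
    exact mul_le_one₀ (abs_cos_le_one _) (norm_nonneg _) (hf1 u)
  have hρ1 : ∀ u, |cosProd u| ≤ 1 := fun u => le_of_tendsto (tendsto_cosPartialProd u).abs
    (Eventually.of_forall fun N => abs_cosPartialProd_le_one N u)
  have hi1 := hint _ (continuous_cosPartialProd N).measurable (abs_cosPartialProd_le_one N)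
  have hi2 := hint _ measurable_cosProd hρ1
  set F : ℝ → ℝ := fun u => cos (2 * π * u * c) * cosPartialProd N u * tentTransform (h * u) -
    cos (2 * π * u * c) * cosProd u * tentTransform (h * u) with hF
  have hi : IntegrableOn F (Set.Ioi 0) := hi1.sub hi2
  rw [← mul_sub, ← integral_sub hi1 hi2, abs_mul, abs_of_pos (by positivity : 0 < 2 * h)]
  have hpt : ∀ u, ‖F u‖ ≤
      |cosPartialProd N u - cosProd u| * |tentTransform (h * u)| := by
    intro u
    simp only [hF]
    rw [← sub_mul, ← mul_sub, norm_mul, norm_mul, norm_eq_abs, norm_eq_abs, norm_eq_abs]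
    gcongr
    exact mul_le_of_le_one_left (abs_nonneg _) (abs_cos_le_one _)
  rw [← Set.Ioc_union_Ioi_eq_Ioi hT0.le, setIntegral_union (Set.Ioc_disjoint_Ioi le_rfl)
    measurableSet_Ioi (hi.mono_set Set.Ioc_subset_Ioi_self)
    (hi.mono_set (Set.Ioi_subset_Ioi hT0.le))]
  have hA : |∫ u in Set.Ioc 0 T, F u| ≤ ε / 4 := by
    refine le_trans ?_ hN1
    rw [← norm_eq_abs]
    refine norm_integral_le_of_norm_le ?_ (Eventually.of_forall fun u => (hpt u).trans
      (mul_le_of_le_one_right (abs_nonneg _) (abs_tentTransform_le_one _)))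
    exact ((continuous_cosPartialProd N).integrableOn_Ioc.sub
      (integrableOn_cosProd.mono_set Set.Ioc_subset_Ioi_self)).abs
  have hB : |∫ u in Set.Ioi T, F u| ≤ 2 / h ^ 2 * (1 / T) := by
    obtain ⟨h1, h2⟩ := integral_Ioi_one_div_sq hT0
    rw [← h2, ← integral_const_mul, ← norm_eq_abs]
    refine norm_integral_le_of_norm_le (h1.const_mul _) ?_
    filter_upwards [ae_restrict_mem measurableSet_Ioi] with u hu
    have hu0 : 0 < u := hT0.trans hu
    refine (hpt u).trans ?_
    have h3 : |cosPartialProd N u - cosProd u| ≤ 2 := by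
      have := abs_sub (cosPartialProd N u) (cosProd u)
      linarith [abs_cosPartialProd_le_one N u, hρ1 u]
    calc _ ≤ 2 * (1 / (h * u) ^ 2) := by
          gcongr
          exact abs_tentTransform_le (by positivity)
      _ = _ := by field_simp
  have hB' : 2 / h ^ 2 * (1 / T) ≤ ε / 4 := by
    rw [div_mul_div_comm, mul_one, div_le_div_iff₀ (by positivity) (by norm_num)]
    rw [div_le_iff₀ hε] at hhT
    linarith
  have := abs_add_le (∫ u in Set.Ioc 0 T, F u) (∫ u in Set.Ioi T, F u)
  calc 2 * h * _ ≤ 2 * h * (ε / 2) := by gcongr; linarith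
    _ = ε * h := by ring

/-! ### From tents to intervals. -/

/-- Integer translates of the tent form a partition of unity; consecutive ones add up to a
trapezoid, equal to 1 on `[0, n]`. -/
theorem sum_tent_sub (n : ℕ) (t : ℝ) :
    ∑ j ∈ Finset.range (n + 1), tent (t - j) = max 0 (min 1 (min (t + 1) (n + 1 - t))) := by
  induction n with
  | zero =>
    simp only [zero_add, Finset.sum_range_one, tent]
    push_cast
    simp only [sub_zero, zero_add]
    rcases abs_cases t with ⟨h, _⟩ | ⟨h, _⟩ <;> rw [h] <;> grind
  | succ n ih =>
    rw [Finset.sum_range_succ, ih, tent]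
    push_cast
    have hn : (0 : ℝ) ≤ n := n.cast_nonneg
    generalize (n : ℝ) = r at *
    rcases abs_cases (t - (r + 1)) with ⟨h, _⟩ | ⟨h, _⟩ <;> rw [h] <;> grind

/-- The sum of the interior tents of a partition of `[a, b]` into `n + 2` intervals of length `h`
differs from the indicator function of an interval with endpoints `a`, `b` by at most the two
tents at the endpoints. -/
theorem abs_indicator_sub_sum_tent_le {I : Set ℝ} {a b h : ℝ} {n : ℕ} (hh : 0 < h)
    (hb : b = a + (n + 2) * h) (h1 : Set.Ioo a b ⊆ I) (h2 : I ⊆ Set.Icc a b) (x : ℝ) :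
    |I.indicator 1 x - ∑ j ∈ Finset.range (n + 1), tent ((x - (a + (j + 1) * h)) / h)| ≤
      tent ((x - a) / h) + tent ((x - b) / h) := by
  set t := (x - a) / h with ht
  have hx : x = a + t * h := by rw [ht]; field_simp; ring
  have e1 : ∀ j : ℕ, (x - (a + (j + 1) * h)) / h = (t - 1) - j := by
    intro j; rw [hx]; field_simp; ring
  have e2 : (x - b) / h = t - (n + 2) := by rw [hx, hb]; field_simp; ring
  simp_rw [e1]
  rw [sum_tent_sub, e2, tent, tent]
  have hn : (0 : ℝ) ≤ n := n.cast_nonneg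
  by_cases hI : x ∈ I
  · obtain ⟨h3, h4⟩ := h2 hI
    have h5 : 0 ≤ t := div_nonneg (by linarith) hh.le
    have h6 : t ≤ n + 2 := by rw [ht, div_le_iff₀ hh]; linarith
    rw [Set.indicator_of_mem hI, Pi.one_apply, abs_of_nonneg h5,
      abs_of_nonpos (by linarith : t - (n + 2) ≤ 0)]
    generalize (n : ℝ) = r at *
    rw [abs_le]
    grind
  · rw [Set.indicator_of_notMem hI]
    have h7 : t ≤ 0 ∨ n + 2 ≤ t := by
      by_contra hcon
      push Not at hcon
      refine hI (h1 ⟨?_, ?_⟩)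
      · rw [hx]; nlinarith [mul_pos hcon.1 hh]
      · rw [hx, hb]; nlinarith [mul_lt_mul_of_pos_right hcon.2 hh]
    have h8 : max 0 (min 1 (min (t - 1 + 1) (n + 1 - (t - 1)))) = 0 := by
      generalize (n : ℝ) = r at *
      grind
    rw [h8, sub_zero, abs_zero]
    exact add_nonneg (le_max_right _ _) (le_max_right _ _)

theorem exists_Ioo_subset_subset_Icc {I : Set ℝ} (hI : I.OrdConnected)
    (hb : Bornology.IsBounded I) (hv : 0 < volume.real I) :
    ∃ a b : ℝ, Set.Ioo a b ⊆ I ∧ I ⊆ Set.Icc a b ∧ volume.real I = b - a := by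
  have hne : I.Nonempty := by
    rw [Set.nonempty_iff_ne_empty]
    rintro rfl
    simp at hv
  have h1 : I ⊆ Set.Icc (sInf I) (sSup I) := fun x hx =>
    ⟨csInf_le hb.bddBelow hx, le_csSup hb.bddAbove hx⟩
  have h2 : Set.Ioo (sInf I) (sSup I) ⊆ I := by
    rintro x ⟨hx1, hx2⟩
    obtain ⟨y, hy, hyx⟩ := exists_lt_of_csInf_lt hne hx1
    obtain ⟨z, hz, hxz⟩ := exists_lt_of_lt_csSup hne hx2
    exact hI.out hy hz ⟨hyx.le, hxz.le⟩
  have hle : sInf I ≤ sSup I := csInf_le_csSup hne hb.bddBelow hb.bddAbove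
  refine ⟨_, _, h2, h1, le_antisymm ?_ ?_⟩
  · rw [← Real.volume_real_Icc_of_le hle]
    exact measureReal_mono h1 measure_Icc_lt_top.ne
  · rw [← Real.volume_real_Ioo_of_le hle]
    exact measureReal_mono h2 hb.measure_lt_top.ne

/-- Replacing the indicator by interior tents costs two end tents: at most `2(B + δ)h` under `ν` and
`2Bh` under `g`. The `n + 1` interior tents cost `δh` each. -/
theorem abs_measureReal_sub_integral_le {ν : Measure ℝ} [IsProbabilityMeasure ν] {g : ℝ → ℝ}
    (hg : Continuous g) {B : ℝ} (hB : ∀ x, |g x| ≤ B) {h δ : ℝ} (hh : 0 < h)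
    (hδ : ∀ c, |(∫ x, tent ((x - c) / h) ∂ν) - ∫ x, tent ((x - c) / h) * g x| ≤ δ * h)
    {I : Set ℝ} (hI : I.OrdConnected) {a b : ℝ} {n : ℕ} (hb : b = a + (n + 2) * h)
    (h1 : Set.Ioo a b ⊆ I) (h2 : I ⊆ Set.Icc a b) :
    |ν.real I - ∫ x in I, g x| ≤ (4 * B + (n + 3) * δ) * h := by
  have hIm : MeasurableSet I := hI.measurableSet
  have htc : ∀ c, Continuous fun x => tent ((x - c) / h) := fun c =>
    continuous_tent.comp (by fun_prop)
  have hν : ∀ c, Integrable (fun x => tent ((x - c) / h)) ν := fun c =>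
    (integrable_const (1 : ℝ)).mono' (htc c).aestronglyMeasurable
      (Eventually.of_forall fun x => by
        rw [norm_of_nonneg (tent_nonneg _)]; exact tent_le_one _)
  have hvol : ∀ c, Integrable fun x => tent ((x - c) / h) := integrable_tent_comp hh
  have hvg : ∀ c, Integrable fun x => tent ((x - c) / h) * g x := fun c =>
    (hvol c).mul_bdd (c := B) hg.aestronglyMeasurable (Eventually.of_forall hB)
  have hgI : IntegrableOn g I :=
    (hg.integrableOn_Icc (a := a) (b := b)).mono_set h2
  set A : ℝ → ℝ := fun x => ∑ j ∈ Finset.range (n + 1), tent ((x - (a + (j + 1) * h)) / h) with hA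
  have hAν : Integrable A ν := integrable_finsetSum _ fun j _ => hν _
  have hAg : Integrable fun x => A x * g x := by
    simp_rw [hA, Finset.sum_mul]
    exact integrable_finsetSum _ fun j _ => hvg _
  have hpt : ∀ x, |I.indicator 1 x - A x| ≤ tent ((x - a) / h) + tent ((x - b) / h) :=
    abs_indicator_sub_sum_tent_le hh hb h1 h2
  have hgt : ∀ c, |∫ x, tent ((x - c) / h) * g x| ≤ B * h := by
    intro c
    have h3 : B * h = ∫ x, B * tent ((x - c) / h) := by
      rw [integral_const_mul, integral_tent_comp hh]
    rw [h3, ← norm_eq_abs]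
    refine norm_integral_le_of_norm_le ((hvol c).const_mul B) (Eventually.of_forall fun x => ?_)
    rw [norm_mul, norm_of_nonneg (tent_nonneg _), mul_comm]
    exact mul_le_mul_of_nonneg_right (hB x) (tent_nonneg _)
  have hνt : ∀ c, ∫ x, tent ((x - c) / h) ∂ν ≤ (B + δ) * h := by
    intro c
    have h3 := (abs_le.1 (hδ c)).2
    have h4 := (abs_le.1 (hgt c)).2
    linarith
  have hone : Integrable (I.indicator (1 : ℝ → ℝ)) ν :=
    (integrable_const (1 : ℝ)).indicator hIm
  have s1 : |ν.real I - ∫ x, A x ∂ν| ≤ 2 * (B + δ) * h := by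
    rw [← integral_indicator_one hIm, ← integral_sub hone hAν, ← norm_eq_abs]
    refine (norm_integral_le_of_norm_le ((hν a).add (hν b)) (Eventually.of_forall hpt)).trans ?_
    simp only [Pi.add_apply]
    rw [integral_add (hν a) (hν b)]
    linarith [hνt a, hνt b]
  have s2 : |(∫ x, A x ∂ν) - ∫ x, A x * g x| ≤ (n + 1) * (δ * h) := by
    simp_rw [hA, Finset.sum_mul]
    rw [integral_finsetSum _ fun j _ => hν _, integral_finsetSum _ fun j _ => hvg _,
      ← Finset.sum_sub_distrib]
    refine (Finset.abs_sum_le_sum_abs _ _).trans ((Finset.sum_le_sum fun j _ => hδ _).trans ?_)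
    rw [Finset.sum_const, Finset.card_range, nsmul_eq_mul]
    push_cast
    rfl
  have s3 : |(∫ x, A x * g x) - ∫ x in I, g x| ≤ 2 * B * h := by
    have hgi : Integrable (I.indicator g) := hgI.integrable_indicator hIm
    rw [← integral_indicator hIm, ← integral_sub hAg hgi, ← norm_eq_abs]
    have h3 : ∀ x, ‖A x * g x - I.indicator g x‖ ≤
        B * (tent ((x - a) / h) + tent ((x - b) / h)) := by
      intro x
      have : A x * g x - I.indicator g x = -(g x * (I.indicator 1 x - A x)) := by
        by_cases hx : x ∈ I
        · simp [hx]; ring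
        · simp [hx]; ring
      rw [this, norm_neg, norm_mul]
      exact mul_le_mul (hB x) (hpt x) (norm_nonneg _) ((abs_nonneg _).trans (hB x))
    refine (norm_integral_le_of_norm_le (((hvol a).add (hvol b)).const_mul B)
      (Eventually.of_forall h3)).trans ?_
    simp only [Pi.add_apply]
    rw [integral_const_mul, integral_add (hvol a) (hvol b), integral_tent_comp hh,
      integral_tent_comp hh]
    linarith
  have t1 := abs_sub_le (ν.real I) (∫ x, A x ∂ν) (∫ x in I, g x)
  have t2 := abs_sub_le (∫ x, A x ∂ν) (∫ x, A x * g x) (∫ x in I, g x)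
  linarith

/-! ### The local limit theorem. -/

theorem theorem2 :
    (∀ u : ℝ, Multipliable (fun k : ℕ => Real.cos (2 * Real.pi * u / ((k : ℝ) + 1)))) ∧
    (∀ x : ℝ, MeasureTheory.IntegrableOn
      (fun u : ℝ => Real.cos (2 * Real.pi * u * x) * cosProd u) (Set.Ioi (0 : ℝ))) ∧
    MeasureTheory.LocallyIntegrable limitDensity ∧
    ∀ C : ℝ, 0 < C → C < 1 / Real.log 4 →
      ∀ ε : ℝ, 0 < ε → ∃ N₀ : ℕ, ∀ N : ℕ, N₀ ≤ N →
        ∀ (Ω : Type*) [MeasurableSpace Ω] (P : MeasureTheory.Measure Ω)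
          [MeasureTheory.IsProbabilityMeasure P] (s : Fin N → Ω → ℝ),
          (∀ i, ProbabilityTheory.HasLaw (s i)
            (ProbabilityTheory.uniformOn ({-1, 1} : Set ℝ)) P) →
          ProbabilityTheory.iIndepFun s P →
          ∀ I : Set ℝ, I.OrdConnected → Bornology.IsBounded I →
            Real.exp (-C * Real.log N ^ 2) < MeasureTheory.volume.real I →
            |P.real {ω | signedHarmonicSum N s ω ∈ I} - ∫ x in I, limitDensity x|
              ≤ ε * MeasureTheory.volume.real I := by
  refine ⟨multipliable_cos_div, integrableOn_cos_mul_cosProd,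
    continuous_limitDensity.locallyIntegrable, fun C hC _ ε hε => ?_⟩
  obtain ⟨B, hB0, hB⟩ := exists_abs_limitDensity_le
  -- The number of tents depends on `ε` only: `4B ≤ εn/2` and `(n + 3)ε/4 ≤ (n + 2)ε/2` add up to at
  -- most `ε(n + 2)`.
  obtain ⟨n, hn⟩ := exists_nat_ge (8 * B / ε)
  -- The tents are narrower than `I` by the factor `n + 2`; passing from `C` to `2C` absorbs it once
  -- `exp(C log² N) ≥ n + 2`.
  have hev := eventually_integral_cosPartialProd_sub_le (C := 2 * C) (ε := ε / 4)
    (by positivity) (by positivity)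
  obtain ⟨N₀, hN₀⟩ := eventually_atTop.1
    (hev.and ((tendsto_exp_mul_log_sq hC).eventually_ge_atTop ((n : ℝ) + 2)))
  refine ⟨N₀, fun N hN Ω _ P _ s hs hind I hI hIb hIv => ?_⟩
  obtain ⟨hN1, hN2⟩ := hN₀ N hN
  obtain ⟨a, b, h1, h2, hab⟩ := exists_Ioo_subset_subset_Icc hI hIb ((exp_pos _).trans hIv)
  have hn2 : (0 : ℝ) < n + 2 := by positivity
  set L := volume.real I with hL
  have hL0 : 0 < L := (exp_pos _).trans hIv
  set h := L / (n + 2) with hh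
  have hLh : (n + 2) * h = L := by rw [hh]; field_simp
  have hh0 : 0 < h := by positivity
  have hX : AEMeasurable (signedHarmonicSum N s) P :=
    aemeasurable_signedHarmonicSum fun i => (hs i).aemeasurable
  have : IsProbabilityMeasure (P.map (signedHarmonicSum N s)) :=
    Measure.isProbabilityMeasure_map hX
  have hhC : exp (-(2 * C) * log N ^ 2) ≤ h := by
    rw [hh, le_div_iff₀ hn2]
    calc exp (-(2 * C) * log N ^ 2) * (n + 2)
        ≤ exp (-(2 * C) * log N ^ 2) * exp (C * log N ^ 2) := by gcongr
      _ = exp (-C * log N ^ 2) := by rw [← exp_add]; ring_nf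
      _ ≤ L := hIv.le
  have hφ : ∀ u c, ∫ x, cos (2 * π * u * (x - c)) ∂(P.map (signedHarmonicSum N s)) =
      cos (2 * π * u * c) * cosPartialProd N u := by
    intro u c
    refine integral_cos_mul_sub_of_integral_exp ?_ c
    rw [integral_map hX (by apply Continuous.aestronglyMeasurable; fun_prop)]
    exact integral_exp_signedHarmonicSum hs hind u
  have hmain := abs_measureReal_sub_integral_le (ν := P.map (signedHarmonicSum N s))
    continuous_limitDensity hB (δ := ε / 4) hh0 (fun c => by
      rw [integral_tent_eq hφ hh0, integral_tent_mul_limitDensity hh0]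
      exact hN1 h c hhC) hI (n := n) (by linarith) h1 h2
  rw [map_measureReal_apply_of_aemeasurable hX hI.measurableSet] at hmain
  refine hmain.trans ?_
  rw [← hLh, ← mul_assoc]
  gcongr
  rw [div_le_iff₀ hε] at hn
  nlinarith
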